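/- Let $V$ be a finite-dimensional real vector space, $U\subset V$ an open star-shaped neighbourhood of the origin, and $g$ a smooth pseudo-Riemannian metric on $U$, i.e. a smooth family $(g_\xi)_{\xi\in U}$ of nondegenerate symmetric bilinear forms on $V$; put $\langle\cdot,\cdot\rangle:=g_0$. Assume that $g$ is given in normal coordinates: for every $\xi\in U$ the straight line $t\mapsto t\xi$, $t\in[0,1]$, is a geodesic of the Levi-Civita connection $\nabla$ of $g$. Let $R(x,y)z=\nabla_x\nabla_yz-\nabla_y\nabla_xz-\nabla_{[x,y]}z$ and $R(x,y,z,w)=g(R(x,y)z,w)$ be the curvature tensor, let $\nabla^{\ell)}R$ be its $\ell$-th iterated covariant derivative, and let $\mathcal R^{\ell)}$ be the endomorphism-valued homogeneous polynomial of degree $\ell+2$ on $V$ given at the origin by $$\langle \mathcal R^{\ell)}(\xi)x,y\rangle=\nabla^{\ell)}_{\xi,\dots,\xi}R(x,\xi,\xi,y)\qquad(\xi,x,y\in V).$$ In the free unital associative algebra $\mathbb R\langle X_2,X_3,\dots\rangle$ define $\tilde Q_0:=1$, $$\tilde Q_n:=-\frac1{n(n+1)}\sum_{\ell=2}^{n}\binom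 n\ell(\ell-1)\ell\,X_\ell\,\tilde Q_{n-\ell}\quad(n\ge1),\qquad Q_n:=\sum_{\ell=0}^n\binom n\ell\,\tilde Q_\ell^{\,*}\,\tilde Q_{n-\ell}\quad(n\ge0),$$ where $*$ is the linear anti-automorphism with $X_i^*=X_i$. The elements $Q_n$ depend neither on $V$ nor on $g$, and $Q_\ell$ with $\ell\le k+2$ involves only $X_2,\dots,X_{k+2}$; let $Q_\ell(\mathcal R^{0)},\dots,\mathcal R^{k)})$ be the result of substituting $X_{j+2}=\mathcal R^{j)}$, $0\le j\le k$, where endomorphism-valued functions are multiplied pointwise by composition. **Theorem (Jet Isomorphism Theorem, weak version).** Identify $g_\xi$ with the endomorphism $G(\xi)$ of $V$ determined by $\langle G(\xi)x,y\rangle=g_\xi(x,y)$. Then, for every integer $k\ge0$, the Taylor polynomial of order $k+2$ of $G$ at the origin is $\sum_{\ell=0}^{k+2}\frac1{\ell!}Q_\ell(\mathcal R^{0)},\dots,\mathcal R^{k)})$: for all $0\le\ell\le k+2$ and $\xi\in V$ the $\ell$-th derivative of $G$ at $0$ satisfies $$D^\ell G(0)(\xi,\dots,\xi)=Q_\ell(\mathcal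 R^{0)},\dots,\mathcal R^{k)})(\xi),$$ and $$G(\xi)=\sum_{\ell=0}^{k+2}\frac1{\ell!}\,Q_\ell(\mathcal R^{0)},\dots,\mathcal R^{k)})(\xi)+O(\|\xi\|^{k+3})\qquad(\xi\to0).$$ -/

import Mathlib

open Set Filter Topology Asymptotics
open scoped ContDiff

noncomputable section

namespace NormalJet

/-! ### The universal noncommutative polynomials -/

/-- The free unital associative real algebra on the generators `X_2, X_3, …`. -/
abbrev FreeAlg : Type := FreeAlgebra ℝ {i : ℕ // 2 ≤ i}

/-- The polynomials `Q̃_k` given by `Q̃_0 = 1` and, for `k ≥ 1`,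
`Q̃_k = - 1 / (k (k + 1)) * ∑_{ℓ = 2}^{k} (k choose ℓ) (ℓ - 1) ℓ X_ℓ Q̃_{k - ℓ}`. -/
def Qtilde : ℕ → FreeAlg
  | 0 => 1
  | n + 1 =>
    (-(1 / (((n + 1 : ℕ) : ℝ) * (((n + 1 : ℕ) : ℝ) + 1)))) •
      ∑ ℓ ∈ (Finset.Icc 2 (n + 1)).attach,
        (((n + 1).choose ℓ.1 : ℝ) * ((ℓ.1 : ℝ) - 1) * (ℓ.1 : ℝ)) •
          (FreeAlgebra.ι ℝ ⟨ℓ.1, (Finset.mem_Icc.1 ℓ.2).1⟩ * Qtilde (n + 1 - ℓ.1))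
termination_by k => k
decreasing_by
  have := (Finset.mem_Icc.1 ℓ.2).1
  omega

/-- `Q_k = ∑_{ℓ = 0}^{k} (k choose ℓ) Q̃_ℓ^* Q̃_{k - ℓ}`, where `*` (`star`) is the linear
anti-automorphism of the free algebra that fixes every generator, i.e. reverses words. -/
def Q (k : ℕ) : FreeAlg :=
  ∑ ℓ ∈ Finset.range (k + 1), (k.choose ℓ : ℝ) • (star (Qtilde ℓ) * Qtilde (k - ℓ))

/-- `P(A_0, …, A_k)`: the substitution `X_{ℓ + 2} = A_ℓ` for `ℓ = 0, …, k` (the generators `X_j`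
with `j > k + 2` are replaced by `0`). -/
def substitute {𝒜 : Type*} [Ring 𝒜] [Algebra ℝ 𝒜] {k : ℕ} (A : Fin (k + 1) → 𝒜)
    (P : FreeAlg) : 𝒜 :=
  FreeAlgebra.lift ℝ
    (fun i : {i : ℕ // 2 ≤ i} => if h : i.1 - 2 < k + 1 then A ⟨i.1 - 2, h⟩ else 0) P

/-! ### Pseudo-Riemannian metrics on open subsets of a vector space -/

variable {V : Type*} [NormedAddCommGroup V] [NormedSpace ℝ V]

/-- `g` is a (smooth) pseudo-Riemannian metric on the open set `U`. -/
structure IsPseudoRiemannianMetricOn (g : V → V →L[ℝ] V →L[ℝ] ℝ) (U : Set V) : Prop where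
  smooth : ContDiffOn ℝ ∞ g U
  symm : ∀ p ∈ U, ∀ x y : V, g p x y = g p y x
  nondegenerate : ∀ p ∈ U, ∀ x : V, (∀ y : V, g p x y = 0) → x = 0

/-- The endomorphism `A` with `B (A x) y = h x y`, for a nondegenerate bilinear form `B` on a
finite-dimensional space. -/
def toEndo (B h : V →L[ℝ] V →L[ℝ] ℝ) : V →L[ℝ] V := B.inverse ∘L h

set_option maxSynthPendingDepth 3 in
/-- Right-hand side of the Koszul formula for constant vector fields:
`(x, y, z) ↦ (∂_x g(y, z) + ∂_y g(x, z) - ∂_z g(x, y)) / 2` at `p`. -/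
def koszul (g : V → V →L[ℝ] V →L[ℝ] ℝ) (p : V) : V →L[ℝ] V →L[ℝ] V →L[ℝ] ℝ :=
  (1 / 2 : ℝ) • (fderiv ℝ g p + (fderiv ℝ g p).flip - ContinuousLinearMap.comp
    (ContinuousLinearMap.flipₗᵢ ℝ V V ℝ).toContinuousLinearEquiv.toContinuousLinearMap
    (fderiv ℝ g p).flip)

set_option maxSynthPendingDepth 3 in
theorem koszul_apply (g : V → V →L[ℝ] V →L[ℝ] ℝ) (p x y z : V) :
    koszul g p x y z =
      (1 / 2) * (fderiv ℝ g p x y z + fderiv ℝ g p y x z - fderiv ℝ g p z x y) := by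
  simp [koszul]

/-- The Christoffel form `Γ_p(x, y)` of the Levi-Civita connection: it is characterized by
`g_p(Γ_p(x, y), z) = koszul g p x y z`, and `(∇_X Y)(p) = (∂_X Y)(p) + Γ_p(X(p), Y(p))`. -/
def christoffel (g : V → V →L[ℝ] V →L[ℝ] ℝ) (p : V) : V →L[ℝ] V →L[ℝ] V :=
  (ContinuousLinearMap.compL ℝ V (V →L[ℝ] ℝ) V (g p).inverse) ∘L koszul g p

/-- `γ` is a (`C²`) geodesic on `s`: `γ'' + Γ_γ(γ', γ') = 0`. -/
def IsGeodesicOn (g : V → V →L[ℝ] V →L[ℝ] ℝ) (γ : ℝ → V) (s : Set ℝ) : Prop :=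
  ∀ t ∈ s, ContDiffAt ℝ 2 γ t ∧
    deriv (deriv γ) t + christoffel g (γ t) (deriv γ t) (deriv γ t) = 0

/-- `g` is given in normal coordinates on `U`: the lines `t ↦ t ξ`, `t ∈ [0, 1]`, are geodesics. -/
def IsInNormalCoordinates (g : V → V →L[ℝ] V →L[ℝ] ℝ) (U : Set V) : Prop :=
  ∀ ξ ∈ U, IsGeodesicOn g (fun t => t • ξ) (Icc 0 1)

/-- The curvature endomorphism `R_p(x, y) z = ∇_x ∇_y z - ∇_y ∇_x z` (for constant vector fields
`x, y, z`), written out in terms of `Γ`. -/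
def curvature (g : V → V →L[ℝ] V →L[ℝ] ℝ) (p x y z : V) : V :=
  fderiv ℝ (christoffel g) p x y z - fderiv ℝ (christoffel g) p y x z +
    christoffel g p x (christoffel g p y z) - christoffel g p y (christoffel g p x z)

/-- The curvature tensor `R(x, y, z, w) = g(R(x, y) z, w)` as a tensor field of type `(0, 4)`. -/
def curvatureTensor (g : V → V →L[ℝ] V →L[ℝ] ℝ) (p : V) : V [×4]→L[ℝ] ℝ where
  toFun v := g p (curvature g p (v 0) (v 1) (v 2)) (v 3)
  map_update_add' := by
    intro inst v i x y
    obtain rfl : inst = instDecidableEqFin 4 := Subsingleton.elim _ _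
    fin_cases i <;> simp [curvature] <;> ring
  map_update_smul' := by
    intro inst v i c x
    obtain rfl : inst = instDecidableEqFin 4 := Subsingleton.elim _ _
    fin_cases i <;> simp [curvature] <;> ring
  cont := by
    unfold curvature
    fun_prop

/-- The usual action of an endomorphism `A` as a derivation on covariant tensors:
`(A · T)(x_1, …, x_n) = - ∑_i T(x_1, …, A x_i, …, x_n)`. -/
def derivationAction {n : ℕ} (A : V →L[ℝ] V) (T : V [×n]→L[ℝ] ℝ) : V [×n]→L[ℝ] ℝ :=
  -∑ i : Fin n, T.compContinuousLinearMap
    (Function.update (fun _ => ContinuousLinearMap.id ℝ V) i A)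

theorem derivationAction_apply {n : ℕ} (A : V →L[ℝ] V) (T : V [×n]→L[ℝ] ℝ) (v : Fin n → V) :
    derivationAction A T v = -∑ i : Fin n, T (Function.update v i (A (v i))) := by
  have key : ∀ i : Fin n, (fun j => (Function.update (fun _ => ContinuousLinearMap.id ℝ V) i A :
      Fin n → V →L[ℝ] V) j (v j)) = Function.update v i (A (v i)) := by
    intro i
    funext j
    by_cases hj : j = i
    · subst hj; simp
    · simp [hj]
  simp [derivationAction, key]

variable [FiniteDimensional ℝ V]

/-- The covariant derivative of a covariant tensor field; the first slot of the result is the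
direction of differentiation:
`(∇T)(x_0, x_1, …, x_n) = ∂_{x_0} T(x_1, …, x_n) - ∑_i T(x_1, …, Γ(x_0, x_i), …, x_n)`. -/
def covDeriv (g : V → V →L[ℝ] V →L[ℝ] ℝ) {n : ℕ} (T : V → V [×n]→L[ℝ] ℝ) (p : V) :
    V [×(n + 1)]→L[ℝ] ℝ :=
  ContinuousLinearMap.uncurryLeft (fderiv ℝ T p + LinearMap.toContinuousLinearMap
    { toFun := fun x => derivationAction (christoffel g p x) (T p)
      map_add' := fun x y => by
        ext v
        simp [derivationAction_apply, Finset.sum_add_distrib, add_comm]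
      map_smul' := fun c x => by
        ext v
        simp [derivationAction_apply, Finset.mul_sum] })

theorem covDeriv_apply (g : V → V →L[ℝ] V →L[ℝ] ℝ) {n : ℕ} (T : V → V [×n]→L[ℝ] ℝ) (p : V)
    (v : Fin (n + 1) → V) :
    covDeriv g T p v = fderiv ℝ T p (v 0) (Fin.tail v) -
      ∑ i : Fin n, T p (Function.update (Fin.tail v) i (christoffel g p (v 0) (Fin.tail v i))) := by
  simp [covDeriv, derivationAction_apply, sub_eq_add_neg]

/-- The `k`-times iterated covariant derivative `∇^{k)} R` of the curvature tensor. -/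
def iterCovDerivCurvature (g : V → V →L[ℝ] V →L[ℝ] ℝ) : (k : ℕ) → V → V [×(4 + k)]→L[ℝ] ℝ
  | 0 => curvatureTensor g
  | k + 1 => covDeriv g (iterCovDerivCurvature g k)

/-- `insertFirst ξ k T = T(ξ, …, ξ, ·, ·, ·, ·)` with `k` copies of `ξ`. -/
def insertFirst (ξ : V) : (k : ℕ) → (V [×(4 + k)]→L[ℝ] ℝ) → (V [×4]→L[ℝ] ℝ)
  | 0, T => T
  | k + 1, T => insertFirst ξ k (T.curryLeft ξ)

/-- The bilinear form `(x, y) ↦ S(x, ξ, ξ, y)`. -/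
def jacobiForm (S : V [×4]→L[ℝ] ℝ) (ξ : V) : V →L[ℝ] V →L[ℝ] ℝ :=
  LinearMap.toContinuousBilinearMap (LinearMap.mk₂ ℝ (fun x y => S ![x, ξ, ξ, y])
    (fun x x' y => S.cons_add ![ξ, ξ, y] x x')
    (fun c x y => S.cons_smul ![ξ, ξ, y] c x)
    (fun x y y' => by
      have h : ∀ z : V, ![x, ξ, ξ, z] = Function.update ![x, ξ, ξ, 0] 3 z := by
        intro z; funext j; fin_cases j <;> rfl
      rw [h (y + y'), h y, h y', S.map_update_add])
    (fun c x y => by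
      have h : ∀ z : V, ![x, ξ, ξ, z] = Function.update ![x, ξ, ξ, 0] 3 z := by
        intro z; funext j; fin_cases j <;> rfl
      rw [h (c • y), h y, S.map_update_smul]))

/-- The symmetrized `k`-th covariant derivative of the curvature tensor at the origin,
`𝓡^{k)}(ξ; x, y) = ∇^{k)}_{ξ, …, ξ} R(x, ξ, ξ, y)`. -/
def symCurvForm (g : V → V →L[ℝ] V →L[ℝ] ℝ) (k : ℕ) (ξ : V) : V →L[ℝ] V →L[ℝ] ℝ :=
  jacobiForm (insertFirst ξ k (iterCovDerivCurvature g k 0)) ξ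

/-- `𝓡^{k)}` as an endomorphism-valued polynomial function, via the inner product `g(0)`:
`g_0(𝓡^{k)}(ξ; x), y) = 𝓡^{k)}(ξ; x, y)`. -/
def symCurv (g : V → V →L[ℝ] V →L[ℝ] ℝ) (k : ℕ) (ξ : V) : V →L[ℝ] V :=
  toEndo (g 0) (symCurvForm g k ξ)

end NormalJet

end

open NormalJet

/-! Everything is computed along one radial line `t ↦ t • ξ`. Put `A = Γ(ξ, ·)`, `D F = F' + A F`,
`F_n = D^n 1` (`iterCov`), and let `S_n` be the endomorphism form of `∇^n R(·, ξ, ξ, ·)` with `n`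
derivatives in direction `ξ` (`jacobiOp`). In normal coordinates the lines `t (ξ + s x)` are
geodesics, so `t x` is a Jacobi field: `D²(t 1) + t S_0 = 0`, that is `t (F_2 + S_0) + 2 F_1 = 0`
(`jacobi_equation`). Since `Γ(ξ, ξ) = 0` on the line and `g` is parallel, `S_n' = S_{n+1} - A S_n +
S_n A` (`hasDerivAt_jacobiOp`). Applying `D` repeatedly (`iterCov_jacobi`) and setting `t = 0`
leaves `(n + 3) F_{n+2} + (n + 1) ∑ (n choose i) S_i F_{n-i} = 0`, which is the recursion for `Q̃`
in disguise. Hence `F_n(0) = Q̃_n` evaluated at the `𝓡^{j)}` (`map_Qtilde_eq`). Because the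
connection is metric, the `ℓ`-th derivative of `g(x, y)` along the line is `∑ (ℓ choose i) g(F_{ℓ-i}
x, F_i y)` (`apply_iteratedFDeriv_toEndo`). The `𝓡^{j)}` are self-adjoint for `g 0`, so adjunction
of `F_i(0)` is reversal of words, and the sum at `0` becomes `Q_ℓ`. Taylor's formula gives the
remainder. -/

namespace NormalJet

set_option maxSynthPendingDepth 3
set_option linter.unusedSectionVars false

/-! ### Levi-Civita connection and the symmetries of its curvature -/

section Metric

variable {V : Type*} [NormedAddCommGroup V] [NormedSpace ℝ V] [FiniteDimensional ℝ V]
  {U : Set V} {g : V → V →L[ℝ] V →L[ℝ] ℝ}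

/-- A bilinear form with trivial left kernel on a finite-dimensional space is an isomorphism onto
the dual. -/
theorem exists_equiv_of_nondegenerate (B : V →L[ℝ] V →L[ℝ] ℝ)
    (hB : ∀ x, (∀ y, B x y = 0) → x = 0) :
    ∃ e : V ≃L[ℝ] (V →L[ℝ] ℝ), (e : V →L[ℝ] V →L[ℝ] ℝ) = B := by
  have hinj : Function.Injective (B : V →ₗ[ℝ] V →L[ℝ] ℝ) := by
    rw [injective_iff_map_eq_zero]
    intro x hx
    refine hB x fun y => ?_
    have : B x = 0 := hx
    simp [this]
  have hdim : Module.finrank ℝ V = Module.finrank ℝ (V →L[ℝ] ℝ) := by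
    rw [← Subspace.dual_finrank_eq (K := ℝ) (V := V)]
    exact LinearEquiv.finrank_eq (LinearMap.toContinuousLinearMap (𝕜 := ℝ) (E := V) (F' := ℝ))
  refine ⟨(LinearEquiv.ofInjectiveOfFinrankEq (B : V →ₗ[ℝ] V →L[ℝ] ℝ) hinj
    hdim).toContinuousLinearEquiv, ?_⟩
  ext x y
  rfl

theorem apply_inverse (B : V →L[ℝ] V →L[ℝ] ℝ) (hB : ∀ x, (∀ y, B x y = 0) → x = 0)
    (f : V →L[ℝ] ℝ) : B (B.inverse f) = f := by
  obtain ⟨e, rfl⟩ := exists_equiv_of_nondegenerate B hB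
  simp

theorem toEndo_spec (B h : V →L[ℝ] V →L[ℝ] ℝ) (hB : ∀ x, (∀ y, B x y = 0) → x = 0) (x y : V) :
    B (toEndo B h x) y = h x y := by
  simp [toEndo, apply_inverse B hB]

theorem eq_of_forall_apply (B : V →L[ℝ] V →L[ℝ] ℝ) (hB : ∀ x, (∀ y, B x y = 0) → x = 0)
    {x x' : V} (h : ∀ y, B x y = B x' y) : x = x' :=
  sub_eq_zero.1 (hB _ fun y => by simp [h y])

theorem curvature_swap (g : V → V →L[ℝ] V →L[ℝ] ℝ) (p x y z : V) :
    curvature g p y x z = -curvature g p x y z := by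
  simp only [curvature]
  abel

namespace IsPseudoRiemannianMetricOn

variable (hg : IsPseudoRiemannianMetricOn g U)
include hg

theorem contDiffAt (hU : IsOpen U) {p : V} (hp : p ∈ U) : ContDiffAt ℝ ∞ g p :=
  hg.smooth.contDiffAt (hU.mem_nhds hp)

theorem differentiableAt (hU : IsOpen U) {p : V} (hp : p ∈ U) : DifferentiableAt ℝ g p :=
  (hg.contDiffAt hU hp).differentiableAt (by simp)

/-- Nondegeneracy makes every `g p` an isomorphism onto the dual, and inversion is smooth at
isomorphisms. -/
theorem contDiffOn_inverse (hU : IsOpen U) : ContDiffOn ℝ ∞ (fun p => (g p).inverse) U := by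
  intro p hp
  obtain ⟨e, he⟩ := exists_equiv_of_nondegenerate (g p) (hg.nondegenerate p hp)
  refine ContDiffAt.contDiffWithinAt ?_
  have := contDiffAt_map_inverse (𝕜 := ℝ) (n := ∞) e
  rw [he] at this
  exact this.comp p (hg.contDiffAt hU hp)

theorem contDiffOn_fderiv (hU : IsOpen U) : ContDiffOn ℝ ∞ (fderiv ℝ g) U :=
  hg.smooth.fderiv_of_isOpen hU (by simp)

theorem contDiffOn_koszul (hU : IsOpen U) : ContDiffOn ℝ ∞ (koszul g) U := by
  have h := hg.contDiffOn_fderiv hU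
  have hc : ∀ x, ContDiffOn ℝ ∞ (fun p => fderiv ℝ g p x) U :=
    fun x => h.clm_apply contDiffOn_const
  have hc3 : ∀ x y z, ContDiffOn ℝ ∞ (fun p => fderiv ℝ g p x y z) U :=
    fun x y z => ((hc x).clm_apply contDiffOn_const).clm_apply contDiffOn_const
  rw [contDiffOn_clm_apply]
  intro x
  rw [contDiffOn_clm_apply]
  intro y
  rw [contDiffOn_clm_apply]
  intro z
  simp only [koszul_apply]
  exact contDiffOn_const.mul (((hc3 x y z).add (hc3 y x z)).sub (hc3 z x y))

theorem contDiffOn_christoffel (hU : IsOpen U) : ContDiffOn ℝ ∞ (christoffel g) U := by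
  rw [contDiffOn_clm_apply]
  intro x
  rw [contDiffOn_clm_apply]
  intro y
  exact (hg.contDiffOn_inverse hU).clm_apply
    (((hg.contDiffOn_koszul hU).clm_apply contDiffOn_const).clm_apply contDiffOn_const)

theorem christoffel_spec {p : V} (hp : p ∈ U) (x y z : V) :
    g p (christoffel g p x y) z = koszul g p x y z := by
  have := apply_inverse (g p) (hg.nondegenerate p hp) (koszul g p x y)
  exact congrArg (fun f : V →L[ℝ] ℝ => f z) this

theorem fderiv_symm (hU : IsOpen U) {p : V} (hp : p ∈ U) (x y z : V) :
    fderiv ℝ g p x y z = fderiv ℝ g p x z y := by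
  have h : ∀ y z, fderiv ℝ (fun q => g q y z) p x = fderiv ℝ g p x y z := by
    intro y z
    have h1 := (((hg.differentiableAt hU hp).hasFDerivAt.clm_apply
      (hasFDerivAt_const y p)).clm_apply (hasFDerivAt_const z p)).fderiv
    rw [h1]
    simp
  rw [← h, ← h]
  congr 1
  apply Filter.EventuallyEq.fderiv_eq
  filter_upwards [hU.mem_nhds hp] with q hq using hg.symm q hq y z

theorem christoffel_symm (hU : IsOpen U) {p : V} (hp : p ∈ U) (x y : V) :
    christoffel g p x y = christoffel g p y x := by
  refine eq_of_forall_apply (g p) (hg.nondegenerate p hp) fun z => ?_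
  rw [hg.christoffel_spec hp, hg.christoffel_spec hp, koszul_apply, koszul_apply,
    hg.fderiv_symm hU hp z x y]
  ring

/-- The Levi-Civita connection is metric. -/
theorem fderiv_eq (hU : IsOpen U) {p : V} (hp : p ∈ U) (x y z : V) :
    fderiv ℝ g p x y z = g p (christoffel g p x y) z + g p y (christoffel g p x z) := by
  rw [hg.symm p hp y, hg.christoffel_spec hp, hg.christoffel_spec hp, koszul_apply, koszul_apply,
    hg.fderiv_symm hU hp z x y, hg.fderiv_symm hU hp x z y, hg.fderiv_symm hU hp y x z]
  ring

theorem differentiableAt_christoffel (hU : IsOpen U) {p : V} (hp : p ∈ U) :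
    DifferentiableAt ℝ (christoffel g) p :=
  ((hg.contDiffOn_christoffel hU).contDiffAt (hU.mem_nhds hp)).differentiableAt (by simp)

theorem fderiv_christoffel_symm (hU : IsOpen U) {p : V} (hp : p ∈ U) (x y z : V) :
    fderiv ℝ (christoffel g) p x y z = fderiv ℝ (christoffel g) p x z y := by
  have h : ∀ y z, fderiv ℝ (fun q => christoffel g q y z) p x =
      fderiv ℝ (christoffel g) p x y z := by
    intro y z
    have h1 := (((hg.differentiableAt_christoffel hU hp).hasFDerivAt.clm_apply
      (hasFDerivAt_const y p)).clm_apply (hasFDerivAt_const z p)).fderiv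
    rw [h1]
    simp
  rw [← h, ← h]
  congr 1
  apply Filter.EventuallyEq.fderiv_eq
  filter_upwards [hU.mem_nhds hp] with q hq using hg.christoffel_symm hU hq y z

theorem curvature_bianchi (hU : IsOpen U) {p : V} (hp : p ∈ U) (x y z : V) :
    curvature g p x y z + curvature g p y z x + curvature g p z x y = 0 := by
  simp only [curvature]
  rw [hg.fderiv_christoffel_symm hU hp x z y, hg.fderiv_christoffel_symm hU hp y z x,
    hg.fderiv_christoffel_symm hU hp z y x, hg.christoffel_symm hU hp z y,
    hg.christoffel_symm hU hp x z, hg.christoffel_symm hU hp y x]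
  abel

theorem curvature_self (hU : IsOpen U) {p : V} (hp : p ∈ U) (x y z : V) :
    g p (curvature g p x y z) z = 0 := by
  -- second derivative of `g z z`, expanded with the metric property
  set f : V → ℝ := fun q => g q z z with hf
  have hfs : ContDiffAt ℝ ∞ f p :=
    ((hg.contDiffAt hU hp).clm_apply contDiffAt_const).clm_apply contDiffAt_const
  have hsym := (hfs.of_le (m := 2) (by norm_cast)).isSymmSndFDerivAt (by simp)
  have hfd : ∀ q ∈ U, ∀ v, fderiv ℝ f q v = 2 * g q (christoffel g q v z) z := by
    intro q hq v
    have h1 := (((hg.differentiableAt hU hq).hasFDerivAt.clm_apply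
      (hasFDerivAt_const z q)).clm_apply (hasFDerivAt_const z q)).fderiv
    rw [hf, h1]
    simp only [ContinuousLinearMap.comp_zero, zero_add, ContinuousLinearMap.flip_apply]
    rw [hg.fderiv_eq hU hq, hg.symm q hq z]
    ring
  have hff : DifferentiableAt ℝ (fderiv ℝ f) p :=
    (hfs.fderiv_right (m := 1) (by norm_cast)).differentiableAt (by simp)
  have h2 : ∀ u v, fderiv ℝ (fderiv ℝ f) p u v =
      2 * (g p (christoffel g p u (christoffel g p v z)) z
        + g p (christoffel g p v z) (christoffel g p u z)
        + g p (fderiv ℝ (christoffel g) p u v z) z) := by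
    intro u v
    have h3 : fderiv ℝ (fun q => fderiv ℝ f q v) p u = fderiv ℝ (fderiv ℝ f) p u v := by
      rw [(hff.hasFDerivAt.clm_apply (hasFDerivAt_const v p)).fderiv]
      simp
    rw [← h3]
    have h4 : (fun q => fderiv ℝ f q v) =ᶠ[𝓝 p] fun q => 2 * g q (christoffel g q v z) z := by
      filter_upwards [hU.mem_nhds hp] with q hq using hfd q hq v
    rw [h4.fderiv_eq]
    have h5 := ((((hg.differentiableAt hU hp).hasFDerivAt.clm_apply
      (((hg.differentiableAt_christoffel hU hp).hasFDerivAt.clm_apply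
      (hasFDerivAt_const v p)).clm_apply (hasFDerivAt_const z p))).clm_apply
      (hasFDerivAt_const z p)).const_mul 2).fderiv
    rw [h5]
    simp [hg.fderiv_eq hU hp]
    ring
  have h6 := hsym.eq x y
  rw [h2, h2, hg.symm p hp (christoffel g p y z)] at h6
  simp only [curvature, map_add, map_sub, add_apply,
    sub_apply]
  linarith

theorem curvature_antisymm (hU : IsOpen U) {p : V} (hp : p ∈ U) (x y z w : V) :
    g p (curvature g p x y z) w = -g p (curvature g p x y w) z := by
  have h := hg.curvature_self hU hp x y (z + w)
  have hz := hg.curvature_self hU hp x y z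
  have hw := hg.curvature_self hU hp x y w
  have hadd : curvature g p x y (z + w) = curvature g p x y z + curvature g p x y w := by
    simp only [curvature, map_add]; abel
  rw [hadd] at h
  simp only [map_add, add_apply] at h
  linarith

/-- The classical octahedron argument: four Bianchi identities, one for each choice of last slot,
combine linearly with the two antisymmetries. -/
theorem curvature_pair_symm (hU : IsOpen U) {p : V} (hp : p ∈ U) (x y z w : V) :
    g p (curvature g p x y z) w = g p (curvature g p z w x) y := by
  have b : ∀ x y z w, g p (curvature g p x y z) w + g p (curvature g p y z x) w
      + g p (curvature g p z x y) w = 0 := by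
    intro x y z w
    have := congrArg (fun v => g p v w) (hg.curvature_bianchi hU hp x y z)
    simpa using this
  have s : ∀ x y z w, g p (curvature g p y x z) w = -g p (curvature g p x y z) w := by
    intro x y z w
    rw [curvature_swap g p x y z]; simp
  have a := fun x y z w => hg.curvature_antisymm hU hp x y z w
  linarith [b x y z w, b y z w x, b z w x y, b w x y z, a x y z w, a y z x w, a z x y w,
    a y z w x, a z w y x, a w y z x, a z w x y, a w x z y, a x z w y, a w x y z, a x y w z,
    a y w x z, s x y z w, s y z x w, s z x y w, s x y w z, s w y z x, s y w z x, s x z w y, s z x w y,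
    s x z y w, s w y x z]

/-- The Jacobi operator is self-adjoint. -/
theorem jacobi_symm (hU : IsOpen U) {p : V} (hp : p ∈ U) (x y ξ : V) :
    g p (curvature g p x ξ ξ) y = g p (curvature g p y ξ ξ) x := by
  rw [hg.curvature_pair_symm hU hp x, hg.curvature_antisymm hU hp ξ y x, curvature_swap g p y ξ ξ]
  simp

end IsPseudoRiemannianMetricOn

end Metric

/-! ### Smoothness of tensor fields and insertion of the radial direction -/

section Tensor

variable {V : Type*} [NormedAddCommGroup V] [NormedSpace ℝ V] [FiniteDimensional ℝ V]
  {U : Set V} {g : V → V →L[ℝ] V →L[ℝ] ℝ}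

instance finiteDimensional_continuousMultilinearMap (n : ℕ) :
    FiniteDimensional ℝ (V [×n]→L[ℝ] ℝ) :=
  Module.Finite.of_injective
    (ContinuousMultilinearMap.toMultilinearMapLinear :
      (V [×n]→L[ℝ] ℝ) →ₗ[ℝ] MultilinearMap ℝ (fun _ : Fin n => V) ℝ)
    ContinuousMultilinearMap.toMultilinearMap_injective

/-- Currying off the first slot reduces the claim to linear maps on a finite-dimensional space,
where smoothness can be tested on vectors. -/
theorem contDiffOn_continuousMultilinearMap_of_apply {n : ℕ} {T : V → V [×n]→L[ℝ] ℝ}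
    (h : ∀ v : Fin n → V, ContDiffOn ℝ ∞ (fun p => T p v) U) : ContDiffOn ℝ ∞ T U := by
  induction n with
  | zero =>
    have h1 : T = fun p => (continuousMultilinearCurryFin0 ℝ V ℝ).symm (T p ![]) := by
      funext p
      ext v
      simp [Subsingleton.elim v ![]]
    rw [h1]
    exact (continuousMultilinearCurryFin0 ℝ V ℝ).symm.contDiff.comp_contDiffOn (h ![])
  | succ n ih =>
    have h1 : T = fun p => (continuousMultilinearCurryLeftEquiv ℝ (fun _ : Fin (n + 1) => V) ℝ).symm
        ((T p).curryLeft) := by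
      funext p
      ext v
      simp
    rw [h1]
    refine (continuousMultilinearCurryLeftEquiv ℝ
      (fun _ : Fin (n + 1) => V) ℝ).symm.contDiff.comp_contDiffOn ?_
    rw [contDiffOn_clm_apply]
    intro x
    refine ih fun v => ?_
    simpa using h (Fin.cons x v)

theorem derivationAction_add_left {n : ℕ} (A B : V →L[ℝ] V) (T : V [×n]→L[ℝ] ℝ) :
    derivationAction (A + B) T = derivationAction A T + derivationAction B T := by
  ext v
  simp [derivationAction_apply, Finset.sum_add_distrib, add_comm]

theorem derivationAction_smul_left {n : ℕ} (c : ℝ) (A : V →L[ℝ] V) (T : V [×n]→L[ℝ] ℝ) :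
    derivationAction (c • A) T = c • derivationAction A T := by
  ext v
  simp [derivationAction_apply, Finset.mul_sum]

theorem derivationAction_add_right {n : ℕ} (A : V →L[ℝ] V) (T S : V [×n]→L[ℝ] ℝ) :
    derivationAction A (T + S) = derivationAction A T + derivationAction A S := by
  ext v
  simp [derivationAction_apply, Finset.sum_add_distrib, add_comm]

theorem derivationAction_smul_right {n : ℕ} (c : ℝ) (A : V →L[ℝ] V) (T : V [×n]→L[ℝ] ℝ) :
    derivationAction A (c • T) = c • derivationAction A T := by
  ext v
  simp [derivationAction_apply, Finset.mul_sum]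

theorem contDiffOn_derivationAction {n : ℕ} {A : V → V →L[ℝ] V} {T : V → V [×n]→L[ℝ] ℝ}
    (hA : ContDiffOn ℝ ∞ A U) (hT : ContDiffOn ℝ ∞ T U) :
    ContDiffOn ℝ ∞ (fun p => derivationAction (A p) (T p)) U :=
  (((LinearMap.mk₂ ℝ (fun (A : V →L[ℝ] V) (T : V [×n]→L[ℝ] ℝ) => derivationAction A T)
    derivationAction_add_left derivationAction_smul_left derivationAction_add_right
    derivationAction_smul_right).toContinuousBilinearMap.contDiff.comp_contDiffOn hA).clm_apply hT :)

theorem contDiffOn_covDeriv (hU : IsOpen U) (hΓ : ContDiffOn ℝ ∞ (christoffel g) U) {n : ℕ}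
    {T : V → V [×n]→L[ℝ] ℝ} (hT : ContDiffOn ℝ ∞ T U) : ContDiffOn ℝ ∞ (covDeriv g T) U := by
  refine (continuousMultilinearCurryLeftEquiv ℝ
    (fun _ : Fin (n + 1) => V) ℝ).symm.contDiff.comp_contDiffOn
      ((hT.fderiv_of_isOpen hU (by simp)).add ?_)
  rw [contDiffOn_clm_apply]
  intro x
  exact contDiffOn_derivationAction (hΓ.clm_apply contDiffOn_const) hT

theorem IsPseudoRiemannianMetricOn.contDiffOn_curvatureTensor
    (hg : IsPseudoRiemannianMetricOn g U) (hU : IsOpen U) :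
    ContDiffOn ℝ ∞ (curvatureTensor g) U := by
  have hΓ := hg.contDiffOn_christoffel hU
  have hdΓ : ContDiffOn ℝ ∞ (fderiv ℝ (christoffel g)) U := hΓ.fderiv_of_isOpen hU (by simp)
  refine contDiffOn_continuousMultilinearMap_of_apply fun v => ?_
  have h1 : ∀ x y z : V, ContDiffOn ℝ ∞ (fun p => fderiv ℝ (christoffel g) p x y z) U :=
    fun x y z => ((hdΓ.clm_apply contDiffOn_const).clm_apply contDiffOn_const).clm_apply
      contDiffOn_const
  have h2 : ∀ x y z : V, ContDiffOn ℝ ∞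
      (fun p => christoffel g p x (christoffel g p y z)) U :=
    fun x y z => (hΓ.clm_apply contDiffOn_const).clm_apply
      ((hΓ.clm_apply contDiffOn_const).clm_apply contDiffOn_const)
  exact (hg.smooth.clm_apply ((((h1 _ _ _).sub (h1 _ _ _)).add (h2 _ _ _)).sub
    (h2 _ _ _))).clm_apply contDiffOn_const

theorem IsPseudoRiemannianMetricOn.contDiffOn_iterCovDerivCurvature
    (hg : IsPseudoRiemannianMetricOn g U) (hU : IsOpen U) (k : ℕ) :
    ContDiffOn ℝ ∞ (iterCovDerivCurvature g k) U := by
  induction k with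
  | zero => exact hg.contDiffOn_curvatureTensor hU
  | succ k ih => exact contDiffOn_covDeriv hU (hg.contDiffOn_christoffel hU) ih

/-- The summand in which `A` hits the inserted `ξ` vanishes, so inserting `ξ` commutes with the
action of `A`. -/
theorem curryLeft_derivationAction {n : ℕ} (A : V →L[ℝ] V) (T : V [×(n + 1)]→L[ℝ] ℝ) {ξ : V}
    (hξ : A ξ = 0) :
    (derivationAction A T).curryLeft ξ = derivationAction A (T.curryLeft ξ) := by
  ext v
  have h0 : T (Fin.cons 0 v) = 0 := T.map_coord_zero 0 (by simp)
  simp [derivationAction_apply, Fin.sum_univ_succ, hξ, h0, ← Fin.cons_update]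

theorem insertFirst_derivationAction {k : ℕ} (A : V →L[ℝ] V) (T : V [×(4 + k)]→L[ℝ] ℝ) {ξ : V}
    (hξ : A ξ = 0) :
    insertFirst ξ k (derivationAction A T) = derivationAction A (insertFirst ξ k T) := by
  induction k with
  | zero => rfl
  | succ k ih =>
    simp only [insertFirst]
    rw [← ih]
    congr 1
    exact curryLeft_derivationAction A T hξ

theorem insertFirst_add (ξ : V) (k : ℕ) (T S : V [×(4 + k)]→L[ℝ] ℝ) :
    insertFirst ξ k (T + S) = insertFirst ξ k T + insertFirst ξ k S := by
  induction k with
  | zero => rfl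
  | succ k ih => exact ih (T.curryLeft ξ) (S.curryLeft ξ)

theorem insertFirst_smul (ξ : V) (k : ℕ) (c : ℝ) (T : V [×(4 + k)]→L[ℝ] ℝ) :
    insertFirst ξ k (c • T) = c • insertFirst ξ k T := by
  induction k with
  | zero => rfl
  | succ k ih => exact ih (T.curryLeft ξ)

theorem jacobiForm_apply (S : V [×4]→L[ℝ] ℝ) (ξ x y : V) :
    jacobiForm S ξ x y = S ![x, ξ, ξ, y] := rfl

/-- `T ↦ T(ξ, …, ξ, ·, ξ, ξ, ·)` as a continuous linear map. -/
noncomputable def insertJacobi (ξ : V) (k : ℕ) : (V [×(4 + k)]→L[ℝ] ℝ) →L[ℝ] (V →L[ℝ] V →L[ℝ] ℝ) :=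
  LinearMap.toContinuousLinearMap
    { toFun := fun T => jacobiForm (insertFirst ξ k T) ξ
      map_add' := fun T S => by
        ext x y
        simp [insertFirst_add, jacobiForm_apply]
      map_smul' := fun c T => by
        ext x y
        simp [insertFirst_smul, jacobiForm_apply] }

theorem insertJacobi_apply (ξ : V) (k : ℕ) (T : V [×(4 + k)]→L[ℝ] ℝ) :
    insertJacobi ξ k T = jacobiForm (insertFirst ξ k T) ξ := rfl

theorem insertJacobi_derivationAction {k : ℕ} (A : V →L[ℝ] V) (T : V [×(4 + k)]→L[ℝ] ℝ) {ξ : V}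
    (hξ : A ξ = 0) (x y : V) :
    insertJacobi ξ k (derivationAction A T) x y =
      -(insertJacobi ξ k T (A x) y + insertJacobi ξ k T x (A y)) := by
  simp only [insertJacobi_apply, insertFirst_derivationAction A T hξ, jacobiForm_apply,
    derivationAction_apply]
  set S := insertFirst ξ k T
  have h1 : S (Function.update ![x, ξ, ξ, y] 1 0) = 0 := S.map_coord_zero 1 (by simp)
  have h2 : S (Function.update ![x, ξ, ξ, y] 2 0) = 0 := S.map_coord_zero 2 (by simp)
  have h3 : Function.update ![x, ξ, ξ, y] 3 (A y) = ![x, ξ, ξ, A y] := by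
    funext j; fin_cases j <;> rfl
  have h4 : Function.update ![x, ξ, ξ, y] 0 (A x) = ![A x, ξ, ξ, y] := by
    funext j; fin_cases j <;> rfl
  simp [Fin.sum_univ_four, hξ, h1, h2, h3, h4]

/-- As `Γ(ξ, ξ) = 0`, the connection terms survive only in the two free slots. -/
theorem insertJacobi_covDeriv {k : ℕ} (T : V → V [×(4 + k)]→L[ℝ] ℝ) {p ξ : V}
    (hξ : christoffel g p ξ ξ = 0) (x y : V) :
    insertJacobi ξ (k + 1) (covDeriv g T p) x y = insertJacobi ξ k (fderiv ℝ T p ξ) x y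
      - insertJacobi ξ k (T p) (christoffel g p ξ x) y
      - insertJacobi ξ k (T p) x (christoffel g p ξ y) := by
  have h : insertJacobi ξ (k + 1) (covDeriv g T p) =
      insertJacobi ξ k (fderiv ℝ T p ξ + derivationAction (christoffel g p ξ) (T p)) := by
    simp only [insertJacobi_apply, insertFirst]
    rfl
  rw [h, map_add]
  simp only [add_apply, insertJacobi_derivationAction _ _ hξ]
  ring

end Tensor

/-! ### The recursion for `Q̃` in closed form -/

section Algebra

variable {𝒜 : Type*} [Ring 𝒜] [Algebra ℝ 𝒜]

theorem map_Qtilde_succ (φ : FreeAlg →ₐ[ℝ] 𝒜) (a : ℕ → 𝒜)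
    (ha : ∀ i : {i : ℕ // 2 ≤ i}, φ (FreeAlgebra.ι ℝ i) = a i) (n : ℕ) :
    φ (Qtilde (n + 1)) = (-(1 / (((n + 1 : ℕ) : ℝ) * (((n + 1 : ℕ) : ℝ) + 1)))) •
      ∑ ℓ ∈ Finset.Icc 2 (n + 1),
        (((n + 1).choose ℓ : ℝ) * ((ℓ : ℝ) - 1) * (ℓ : ℝ)) • (a ℓ * φ (Qtilde (n + 1 - ℓ))) := by
  rw [Qtilde, map_smul, map_sum]
  congr 1
  rw [← Finset.sum_attach (Finset.Icc 2 (n + 1))]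
  refine Finset.sum_congr rfl fun ℓ _ => ?_
  rw [map_smul, map_mul, ha]

/-- Absorption used twice. It turns the weights in the definition of `Qtilde` into plain binomials
times `(n + 1)(n + 2)`, so that only the factor `-(n + 1) / (n + 3)` remains. -/
theorem choose_add_two_mul (n j : ℕ) :
    ((n + 2).choose (j + 2) : ℝ) * ((j : ℝ) + 1) * ((j : ℝ) + 2) =
      ((n : ℝ) + 1) * ((n : ℝ) + 2) * (n.choose j : ℝ) := by
  have h1 : ((n : ℝ) + 1) * (n.choose j : ℝ) = ((n + 1).choose (j + 1) : ℝ) * ((j : ℝ) + 1) := by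
    exact_mod_cast Nat.add_one_mul_choose_eq n j
  have h2 : ((n : ℝ) + 2) * ((n + 1).choose (j + 1) : ℝ) =
      ((n + 2).choose (j + 2) : ℝ) * ((j : ℝ) + 2) := by
    exact_mod_cast Nat.add_one_mul_choose_eq (n + 1) (j + 1)
  linear_combination (-(j : ℝ) - 1) * h2 - ((n : ℝ) + 2) * h1

/-- The recursion solved by the polynomials `Q̃_n`. -/
theorem map_Qtilde_eq (φ : FreeAlg →ₐ[ℝ] 𝒜) (S F : ℕ → 𝒜) (K : ℕ)
    (hφ : ∀ i : {i : ℕ // 2 ≤ i}, i.1 ≤ K → φ (FreeAlgebra.ι ℝ i) = S (i.1 - 2))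
    (h0 : F 0 = 1) (h1 : F 1 = 0)
    (h2 : ∀ n : ℕ, ((n : ℝ) + 3) • F (n + 2) +
      ((n : ℝ) + 1) • ∑ ij ∈ Finset.HasAntidiagonal.antidiagonal n,
        n.choose ij.1 • (S ij.1 * F ij.2) = 0) :
    ∀ n ≤ K, φ (Qtilde n) = F n := by
  -- The generators start at index 2; the values of `a` at 0 and 1 are never used.
  set a : ℕ → 𝒜 := fun i => if h : 2 ≤ i then φ (FreeAlgebra.ι ℝ ⟨i, h⟩) else 0 with ha
  have ha' : ∀ i : {i : ℕ // 2 ≤ i}, φ (FreeAlgebra.ι ℝ i) = a i := fun i => by simp [ha, i.2]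
  have haS : ∀ j, j + 2 ≤ K → a (j + 2) = S j := fun j hj => by
    rw [← ha' ⟨j + 2, by omega⟩, hφ _ hj]
    rfl
  intro n
  induction n using Nat.strong_induction_on with
  | _ n ih =>
    intro hn
    match n, ih, hn with
    | 0, _, _ => simp [Qtilde, h0]
    | 1, _, _ => rw [map_Qtilde_succ φ a ha']; simp [h1]
    | n + 2, ih, hn =>
      have hsum : ∑ ℓ ∈ Finset.Icc 2 (n + 1 + 1), (((n + 1 + 1).choose ℓ : ℝ) * ((ℓ : ℝ) - 1) *
            (ℓ : ℝ)) • (a ℓ * φ (Qtilde (n + 1 + 1 - ℓ))) =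
          (((n : ℝ) + 1) * ((n : ℝ) + 2)) •
            ∑ ij ∈ Finset.HasAntidiagonal.antidiagonal n, n.choose ij.1 • (S ij.1 * F ij.2) := by
        rw [Finset.Nat.sum_antidiagonal_eq_sum_range_succ_mk, ← Finset.Ico_add_one_right_eq_Icc,
          Finset.sum_Ico_eq_sum_range, Finset.smul_sum]
        refine Finset.sum_congr (by congr 1) fun j hj => ?_
        have hj' : j ≤ n := by simpa [Nat.lt_succ_iff] using hj
        rw [add_comm 2 j, haS j (by omega), show n + 1 + 1 - (j + 2) = n - j by omega,
          ih (n - j) (by omega) (by omega), ← Nat.cast_smul_eq_nsmul ℝ, smul_smul,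
          ← choose_add_two_mul]
        congr 1
        push_cast
        ring
      have h3 := h2 n
      rw [map_Qtilde_succ φ a ha' (n + 1), hsum, smul_smul]
      set X := ∑ ij ∈ Finset.HasAntidiagonal.antidiagonal n, n.choose ij.1 • (S ij.1 * F ij.2)
      have hn3 : (n : ℝ) + 3 ≠ 0 := by positivity
      have hn2 : (n : ℝ) + 2 ≠ 0 := by positivity
      have h4 : F (n + 2) = (-(((n : ℝ) + 1) / ((n : ℝ) + 3))) • X := by
        have h5 := eq_neg_of_add_eq_zero_left h3
        rw [← inv_smul_smul₀ hn3 (F (n + 2)), h5, ← neg_smul, smul_smul]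
        congr 1
        field_simp
      rw [h4]
      congr 1
      push_cast
      rw [show (n : ℝ) + 1 + 1 = n + 2 by ring, show (n : ℝ) + 2 + 1 = n + 3 by ring]
      field_simp

end Algebra

/-! ### Covariant Leibniz rule and the differentiated Jacobi equation -/

section Curve

/-- Pascal's rule. It serves twice: with `L` left multiplication by `A` for the products `S_i F_j`,
and with `L = 0` for the scalars `g(F_j x, F_i y)`. -/
theorem hasDerivAt_leibniz_sum {W : Type*} [NormedAddCommGroup W] [NormedSpace ℝ W]
    (c : ℕ → ℕ → ℝ → W) (L : W →+ W) (t : ℝ)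
    (hc : ∀ i j, HasDerivAt (c i j) (c (i + 1) j t + c i (j + 1) t - L (c i j t)) t) (n : ℕ) :
    HasDerivAt (fun s => ∑ ij ∈ Finset.HasAntidiagonal.antidiagonal n, n.choose ij.1 • c ij.1 ij.2 s)
      (∑ ij ∈ Finset.HasAntidiagonal.antidiagonal (n + 1), (n + 1).choose ij.1 • c ij.1 ij.2 t
        - L (∑ ij ∈ Finset.HasAntidiagonal.antidiagonal n, n.choose ij.1 • c ij.1 ij.2 t)) t := by
  have h := HasDerivAt.fun_sum (u := Finset.HasAntidiagonal.antidiagonal n) (x := t)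
    (A := fun (ij : ℕ × ℕ) s => n.choose ij.1 • c ij.1 ij.2 s)
    fun ij _ => (hc ij.1 ij.2).const_smul (n.choose ij.1)
  convert h using 1
  rw [Finset.sum_antidiagonal_choose_succ_nsmul (fun i j => c i j t)]
  simp only [smul_sub, smul_add, Finset.sum_sub_distrib, Finset.sum_add_distrib, map_sum, map_nsmul]
  congr 1
  rw [add_comm]
  congr 1
  refine Finset.sum_congr rfl fun ij hij => ?_
  rw [← Finset.HasAntidiagonal.mem_antidiagonal.1 hij, Nat.choose_symm_add]

variable {𝒜 : Type*} [NormedRing 𝒜] [NormedAlgebra ℝ 𝒜]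

/-- The iterated covariant derivatives `D^n 1`, `D F = F' + A F`, along a curve. -/
noncomputable def iterCov (A : ℝ → 𝒜) : ℕ → ℝ → 𝒜
  | 0 => 1
  | n + 1 => fun t => deriv (iterCov A n) t + A t * iterCov A n t

variable {I : Set ℝ} {A : ℝ → 𝒜}

theorem contDiffOn_iterCov (hI : IsOpen I) (hA : ContDiffOn ℝ ∞ A I) (n : ℕ) :
    ContDiffOn ℝ ∞ (iterCov A n) I := by
  induction n with
  | zero => exact contDiffOn_const
  | succ n ih => exact (ih.deriv_of_isOpen hI (by simp)).add (hA.mul ih)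

theorem hasDerivAt_iterCov (hI : IsOpen I) (hA : ContDiffOn ℝ ∞ A I) (n : ℕ) {t : ℝ}
    (ht : t ∈ I) :
    HasDerivAt (iterCov A n) (iterCov A (n + 1) t - A t * iterCov A n t) t := by
  have h := (((contDiffOn_iterCov hI hA n).contDiffAt (hI.mem_nhds ht)).differentiableAt
    (by simp)).hasDerivAt
  refine h.congr_deriv ?_
  exact (add_sub_cancel_right (deriv (iterCov A n) t) (A t * iterCov A n t)).symm

/-- All covariant derivatives of the Jacobi equation `D²(t 1) + t S = 0`. -/
theorem iterCov_jacobi (hI : IsOpen I) (hA : ContDiffOn ℝ ∞ A I) (S : ℕ → ℝ → 𝒜)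
    (hS : ∀ n, ∀ t ∈ I, HasDerivAt (S n) (S (n + 1) t - A t * S n t + S n t * A t) t)
    (hJ : ∀ t ∈ I, t • (iterCov A 2 t + S 0 t) + (2 : ℝ) • iterCov A 1 t = 0)
    (n : ℕ) : ∀ t ∈ I,
      t • (iterCov A (n + 2) t +
          ∑ ij ∈ Finset.HasAntidiagonal.antidiagonal n, n.choose ij.1 • (S ij.1 t * iterCov A ij.2 t)) +
        ((n : ℝ) + 2) • iterCov A (n + 1) t +
        (n : ℝ) • ∑ ij ∈ Finset.HasAntidiagonal.antidiagonal (n - 1),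
          (n - 1).choose ij.1 • (S ij.1 t * iterCov A ij.2 t) = 0 := by
  set W : ℕ → ℝ → 𝒜 := fun n t =>
    ∑ ij ∈ Finset.HasAntidiagonal.antidiagonal n,
      n.choose ij.1 • (S ij.1 t * iterCov A ij.2 t) with hWdef
  have hF := fun n t (ht : t ∈ I) => hasDerivAt_iterCov hI hA n ht
  have hW : ∀ n, ∀ t ∈ I, HasDerivAt (W n) (W (n + 1) t - A t * W n t) t := by
    intro n t ht
    refine hasDerivAt_leibniz_sum (fun i j s => S i s * iterCov A j s) (AddMonoidHom.mulLeft (A t))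
      t (fun i j => ?_) n
    refine ((hS i t ht).mul (hF j t ht)).congr_deriv ?_
    simp only [AddMonoidHom.coe_mulLeft]
    noncomm_ring
  -- At `n = 0` the truncated index `n - 1` is harmless, because the coefficient `n` kills the term.
  have hW' : ∀ n : ℕ, ∀ t ∈ I, HasDerivAt (fun s => (n : ℝ) • W (n - 1) s)
      ((n : ℝ) • (W n t - A t * W (n - 1) t)) t := by
    intro n t ht
    cases n with
    | zero => simpa using hasDerivAt_const t (0 : 𝒜)
    | succ n => exact (hW n t ht).const_smul ((n + 1 : ℕ) : ℝ)
  change ∀ t ∈ I, t • (iterCov A (n + 2) t + W n t) + ((n : ℝ) + 2) • iterCov A (n + 1) t +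
    (n : ℝ) • W (n - 1) t = 0
  induction n with
  | zero =>
    intro t ht
    have : W 0 t = S 0 t := by simp [hWdef, iterCov]
    simpa [this] using hJ t ht
  | succ n ih =>
    intro t ht
    have h1 := (((hasDerivAt_id t).smul ((hF (n + 2) t ht).add (hW n t ht))).add
      ((hF (n + 1) t ht).const_smul ((n : ℝ) + 2))).add (hW' n t ht)
    have h2 : HasDerivAt (fun _ : ℝ => (0 : 𝒜)) 0 t := hasDerivAt_const t 0
    have h3 := h1.unique (h2.congr_of_eventuallyEq (by
      filter_upwards [hI.mem_nhds ht] with s hs using ih s hs))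
    -- Adding `A` times the induction hypothesis to its ordinary derivative gives its covariant
    -- derivative. Differentiating the factor `t` raises the coefficients to `n + 3` and `n + 1`.
    have h4 := congrArg (fun X => A t * X) (ih t ht)
    simp only [mul_add, mul_smul_comm, mul_zero] at h4
    simp only [id, smul_add, smul_sub, one_smul, Pi.add_apply] at h3 h4 ⊢
    rw [Nat.add_sub_cancel]
    have h5 := congrArg₂ (· + ·) h3 h4
    simp only [add_zero] at h5
    rw [← h5]
    push_cast
    module

end Curve

/-! ### Radial geodesics, Jacobi equation and Jacobi operators -/

section Normal

variable {V : Type*} [NormedAddCommGroup V] [NormedSpace ℝ V] [FiniteDimensional ℝ V]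
  {U : Set V} {g : V → V →L[ℝ] V →L[ℝ] ℝ}

theorem IsInNormalCoordinates.christoffel_line (hn : IsInNormalCoordinates g U) {ξ : V}
    (hξ : ξ ∈ U) {t : ℝ} (ht : t ∈ Icc (0 : ℝ) 1) : christoffel g (t • ξ) ξ ξ = 0 := by
  have h := (hn ξ hξ t ht).2
  have hd : deriv (fun s : ℝ => s • ξ) = fun _ => ξ := by
    funext s
    simpa using ((hasDerivAt_id s).smul_const ξ).deriv
  rw [hd] at h
  simpa using h

theorem IsInNormalCoordinates.christoffel_self (hn : IsInNormalCoordinates g U) {η : V}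
    (hη : η ∈ U) : christoffel g η η η = 0 := by
  simpa using hn.christoffel_line hη (t := 1) (by simp)

variable (hg : IsPseudoRiemannianMetricOn g U) (hU : IsOpen U) (hn : IsInNormalCoordinates g U)

/-- The line through the origin in direction `ξ` meets `U` in an open set of parameters. -/
theorem isOpen_smul_preimage (hU : IsOpen U) (ξ : V) : IsOpen {t : ℝ | t • ξ ∈ U} :=
  hU.preimage (by fun_prop)

include hg hU hn

/-- For small `t ≠ 0` the point `t x` lies in `U`, and the geodesic equation of its radial line at
parameter `0` gives `Γ_0(x, x) = 0`. Then polarize. -/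
theorem christoffel_zero (h0 : (0 : V) ∈ U) (x y : V) : christoffel g 0 x y = 0 := by
  have hd : ∀ x, christoffel g 0 x x = 0 := by
    intro x
    have h1 : ∀ᶠ t : ℝ in 𝓝 0, t • x ∈ U :=
      (isOpen_smul_preimage hU x).mem_nhds (by simpa using h0)
    obtain ⟨t, ht, ht0⟩ := ((h1.filter_mono nhdsWithin_le_nhds).and
      (self_mem_nhdsWithin : {(0 : ℝ)}ᶜ ∈ 𝓝[≠] 0)).exists
    have h2 := hn.christoffel_line ht (t := 0) (by simp)
    have ht0' : t ≠ 0 := ht0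
    simpa [ht0'] using h2
  have h := hd (x + y)
  simp only [map_add, add_apply, hd, zero_add, add_zero] at h
  rw [hg.christoffel_symm hU h0 y x] at h
  have h2 : (2 : ℝ) • christoffel g 0 x y = 0 := by rw [two_smul]; exact h
  simpa using h2

theorem christoffel_radial (h0 : (0 : V) ∈ U) {t : ℝ} {ξ : V} (h : t • ξ ∈ U) :
    christoffel g (t • ξ) ξ ξ = 0 := by
  rcases eq_or_ne t 0 with rfl | ht
  · rw [zero_smul]
    exact christoffel_zero hg hU hn h0 ξ ξ
  · simpa [ht] using hn.christoffel_self h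

/-- The identity `Γ_η(η, η) = 0` holds on the open set `U`; differentiate it in direction `x`. -/
theorem fderiv_christoffel_self {η : V} (hη : η ∈ U) (x : V) :
    fderiv ℝ (christoffel g) η x η η + (2 : ℝ) • christoffel g η η x = 0 := by
  have h1 := (((hg.differentiableAt_christoffel hU hη).hasFDerivAt.clm_apply
      (hasFDerivAt_id η)).clm_apply (hasFDerivAt_id η))
  have h2 : HasFDerivAt (fun q => christoffel g q q q) (0 : V →L[ℝ] V) η :=
    (hasFDerivAt_const (0 : V) η).congr_of_eventuallyEq (by
      filter_upwards [hU.mem_nhds hη] with q hq using hn.christoffel_self hq)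
  have h3 := congrArg (fun L : V →L[ℝ] V => L x) (h1.unique h2)
  simp at h3
  rw [hg.christoffel_symm hU hη x η] at h3
  rw [← h3]
  module

theorem fderiv_christoffel_radial (h0 : (0 : V) ∈ U) {t : ℝ} {ξ : V} (h : t • ξ ∈ U) (x : V) :
    t • fderiv ℝ (christoffel g) (t • ξ) x ξ ξ + (2 : ℝ) • christoffel g (t • ξ) ξ x = 0 := by
  rcases eq_or_ne t 0 with rfl | ht
  · simp [christoffel_zero hg hU hn h0]
  -- At `η = t ξ` the identity is `t` times the goal.
  · have h1 := fderiv_christoffel_self hg hU hn h x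
    simp only [map_smul, smul_apply] at h1
    apply smul_right_injective V ht
    simp only [smul_add, smul_zero]
    rw [← h1, smul_smul, smul_comm]

omit hn
theorem hasDerivAt_christoffel_line {t : ℝ} {ξ : V} (h : t • ξ ∈ U) :
    HasDerivAt (fun s : ℝ => christoffel g (s • ξ) ξ) (fderiv ℝ (christoffel g) (t • ξ) ξ ξ) t := by
  have h1 := (hg.differentiableAt_christoffel hU h).hasFDerivAt.comp_hasDerivAt t
    ((hasDerivAt_id t).smul_const ξ)
  have h2 := h1.clm_apply (hasDerivAt_const t ξ)
  simpa using h2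

theorem contDiffOn_christoffel_line (ξ : V) :
    ContDiffOn ℝ ∞ (fun s : ℝ => christoffel g (s • ξ) ξ) {t : ℝ | t • ξ ∈ U} :=
  ((hg.contDiffOn_christoffel hU).comp (f := fun s : ℝ => s • ξ) (by fun_prop)
    fun _ ht => ht).clm_apply contDiffOn_const

omit hg hU

/-- The iterated covariant derivatives of the Jacobi operator along `t ↦ t ξ`. -/
noncomputable def jacobiOp (g : V → V →L[ℝ] V →L[ℝ] ℝ) (ξ : V) (k : ℕ) (t : ℝ) : V →L[ℝ] V :=
  toEndo (g (t • ξ)) (insertJacobi ξ k (iterCovDerivCurvature g k (t • ξ)))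

theorem jacobiOp_zero (g : V → V →L[ℝ] V →L[ℝ] ℝ) (ξ : V) (k : ℕ) :
    jacobiOp g ξ k 0 = symCurv g k ξ := by
  simp only [jacobiOp, zero_smul]
  rfl

include hg
theorem jacobiOp_spec {t : ℝ} {ξ : V} (h : t • ξ ∈ U) (k : ℕ) (x y : V) :
    g (t • ξ) (jacobiOp g ξ k t x) y =
      insertJacobi ξ k (iterCovDerivCurvature g k (t • ξ)) x y :=
  toEndo_spec _ _ (hg.nondegenerate _ h) x y

theorem jacobiOp_curvature {t : ℝ} {ξ : V} (h : t • ξ ∈ U) (x : V) :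
    jacobiOp g ξ 0 t x = curvature g (t • ξ) x ξ ξ := by
  refine eq_of_forall_apply (g (t • ξ)) (hg.nondegenerate _ h) fun y => ?_
  rw [jacobiOp_spec hg h]
  rfl

include hU hn

/-- Here `F_1 = A` and `F_2 = A' + A²`. In `F_2 x + R(x, ξ)ξ` everything cancels except `∂_x Γ(ξ,
ξ)`, so the claim is `fderiv_christoffel_radial`. -/
theorem jacobi_equation (h0 : (0 : V) ∈ U) (ξ : V) {t : ℝ} (h : t • ξ ∈ U) :
    t • (iterCov (fun s : ℝ => christoffel g (s • ξ) ξ) 2 t + jacobiOp g ξ 0 t) +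
      (2 : ℝ) • iterCov (fun s : ℝ => christoffel g (s • ξ) ξ) 1 t = 0 := by
  have h1 : iterCov (fun s : ℝ => christoffel g (s • ξ) ξ) 1 =
      fun s : ℝ => christoffel g (s • ξ) ξ := by
    funext s
    have : iterCov (fun s : ℝ => christoffel g (s • ξ) ξ) 0 = fun _ => 1 := rfl
    simp only [iterCov.eq_2, this, deriv_const, zero_add, mul_one]
  simp only [iterCov.eq_2 _ 1, h1]
  rw [(hasDerivAt_christoffel_line hg hU h).deriv]
  ext x
  have h2 := fderiv_christoffel_radial hg hU hn h0 h x
  simp only [add_apply, smul_apply, mul_apply_eq_comp, zero_apply,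
    jacobiOp_curvature hg h, curvature]
  rw [christoffel_radial hg hU hn h0 h, hg.christoffel_symm hU h x ξ, map_zero,
    hg.fderiv_christoffel_symm hU h ξ x ξ]
  refine Eq.trans ?_ h2
  module

/-- `∇^{k)} R` along a radial line in terms of `∇^{k - 1)} R`. -/
theorem hasDerivAt_insertJacobi (h0 : (0 : V) ∈ U) (ξ : V) {t : ℝ} (h : t • ξ ∈ U) (k : ℕ)
    (x y : V) :
    HasDerivAt (fun s : ℝ => insertJacobi ξ k (iterCovDerivCurvature g k (s • ξ)) x y)
      (insertJacobi ξ (k + 1) (iterCovDerivCurvature g (k + 1) (t • ξ)) x y +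
        insertJacobi ξ k (iterCovDerivCurvature g k (t • ξ)) (christoffel g (t • ξ) ξ x) y +
        insertJacobi ξ k (iterCovDerivCurvature g k (t • ξ)) x (christoffel g (t • ξ) ξ y)) t := by
  have hT : DifferentiableAt ℝ (iterCovDerivCurvature g k) (t • ξ) :=
    ((hg.contDiffOn_iterCovDerivCurvature hU k).contDiffAt (hU.mem_nhds h)).differentiableAt
      (by simp)
  have h1 := hT.hasFDerivAt.comp_hasDerivAt t ((hasDerivAt_id t).smul_const ξ)
  have h2 := (((insertJacobi ξ k).hasFDerivAt.comp_hasDerivAt t h1).clm_apply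
    (hasDerivAt_const t x)).clm_apply (hasDerivAt_const t y)
  refine h2.congr_deriv ?_
  have h3 := insertJacobi_covDeriv (g := g) (iterCovDerivCurvature g k)
    (christoffel_radial hg hU hn h0 h) x y
  have h4 : iterCovDerivCurvature g (k + 1) (t • ξ) =
    covDeriv g (iterCovDerivCurvature g k) (t • ξ) := rfl
  rw [h4, h3]
  simp only [one_smul, map_zero, add_zero]
  ring

omit hn
-- The product rule for a parallel metric, along the radial line.
theorem hasDerivAt_metric_line {ξ : V} {t : ℝ} (h : t • ξ ∈ U) {u v : ℝ → V} {u' v' : V}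
    (hu : HasDerivAt u u' t) (hv : HasDerivAt v v' t) :
    HasDerivAt (fun s : ℝ => g (s • ξ) (u s) (v s))
      (g (t • ξ) (u' + christoffel g (t • ξ) ξ (u t)) (v t) +
        g (t • ξ) (u t) (v' + christoffel g (t • ξ) ξ (v t))) t := by
  have h1 := (hg.differentiableAt hU h).hasFDerivAt.comp_hasDerivAt t
    ((hasDerivAt_id t).smul_const ξ)
  refine ((h1.clm_apply hu).clm_apply hv).congr_deriv ?_
  simp [hg.fderiv_eq hU h]
  ring

theorem contDiffOn_jacobiOp (ξ : V) (k : ℕ) :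
    ContDiffOn ℝ ∞ (jacobiOp g ξ k) {t : ℝ | t • ξ ∈ U} := by
  have h1 : ContDiffOn ℝ ∞ (fun t : ℝ => (g (t • ξ)).inverse) {t : ℝ | t • ξ ∈ U} :=
    (hg.contDiffOn_inverse hU).comp (by fun_prop) fun _ ht => ht
  have h2 : ContDiffOn ℝ ∞ (fun t : ℝ => iterCovDerivCurvature g k (t • ξ))
      {t : ℝ | t • ξ ∈ U} :=
    (hg.contDiffOn_iterCovDerivCurvature hU k).comp (by fun_prop) fun _ ht => ht
  exact h1.clm_comp ((insertJacobi ξ k).contDiff.comp_contDiffOn h2)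

include hn
theorem hasDerivAt_jacobiOp (h0 : (0 : V) ∈ U) (ξ : V) (k : ℕ) {t : ℝ} (h : t • ξ ∈ U) :
    HasDerivAt (jacobiOp g ξ k) (jacobiOp g ξ (k + 1) t -
      christoffel g (t • ξ) ξ * jacobiOp g ξ k t +
      jacobiOp g ξ k t * christoffel g (t • ξ) ξ) t := by
  have hI := isOpen_smul_preimage hU ξ
  have hd := (((contDiffOn_jacobiOp hg hU ξ k).contDiffAt (hI.mem_nhds h)).differentiableAt
    (by simp)).hasDerivAt
  refine hd.congr_deriv ?_
  ext x
  refine eq_of_forall_apply (g (t • ξ)) (hg.nondegenerate _ h) fun y => ?_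
  -- Differentiability is known from smoothness. The value follows by computing the derivative of
  -- `g(S_k x, y)` twice, from `∇g = 0` and from the form `∇^k R`.
  have h1 := hasDerivAt_metric_line hg hU h (hd.clm_apply (hasDerivAt_const t x))
    (hasDerivAt_const t y)
  have h2 := (hasDerivAt_insertJacobi hg hU hn h0 ξ h k x y).congr_of_eventuallyEq
    (f₁ := fun s : ℝ => g (s • ξ) (jacobiOp g ξ k s x) y) (by
      filter_upwards [hI.mem_nhds h] with s hs using jacobiOp_spec hg hs k x y)
  have h3 := h1.unique h2
  simp only [← jacobiOp_spec hg h] at h3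
  simp only [map_zero, add_zero, zero_add, map_add, add_apply, sub_apply, map_sub,
    mul_apply_eq_comp] at h3 ⊢
  linarith

/-- Symmetry of the Jacobi form of `R` passes to `∇^k R` by induction: the formula for the radial
derivative is symmetric in `x` and `y` apart from the new term, which must therefore be symmetric
too. -/
theorem insertJacobi_symm (h0 : (0 : V) ∈ U) (ξ : V) (k : ℕ) :
    ∀ {t : ℝ}, t • ξ ∈ U → ∀ x y : V,
      insertJacobi ξ k (iterCovDerivCurvature g k (t • ξ)) x y =
        insertJacobi ξ k (iterCovDerivCurvature g k (t • ξ)) y x := by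
  induction k with
  | zero => exact fun h x y => hg.jacobi_symm hU h x y ξ
  | succ k ih =>
    intro t h x y
    have h1 := hasDerivAt_insertJacobi hg hU hn h0 ξ h k x y
    have h2 := (hasDerivAt_insertJacobi hg hU hn h0 ξ h k y x).congr_of_eventuallyEq
      (f₁ := fun s : ℝ => insertJacobi ξ k (iterCovDerivCurvature g k (s • ξ)) x y) (by
        filter_upwards [(isOpen_smul_preimage hU ξ).mem_nhds h] with s hs using ih hs x y)
    have h3 := h1.unique h2
    rw [ih h y, ih h _ x] at h3
    linarith

theorem symCurv_symm (h0 : (0 : V) ∈ U) (ξ : V) (k : ℕ) (x y : V) :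
    g 0 (symCurv g k ξ x) y = g 0 x (symCurv g k ξ y) := by
  have h0' : (0 : ℝ) • ξ ∈ U := by simpa using h0
  have h1 := jacobiOp_spec hg h0' k x y
  have h2 := jacobiOp_spec hg h0' k y x
  have h3 := insertJacobi_symm hg hU hn h0 ξ k h0' x y
  rw [hg.symm 0 h0 x]
  simp only [jacobiOp_zero] at h1 h2
  simp only [zero_smul] at h1 h2 h3
  rw [h1, h2, h3]

end Normal

/-! ### Taylor expansion along radial segments -/

section Taylor

variable {V E : Type*} [NormedAddCommGroup V] [NormedSpace ℝ V] [NormedAddCommGroup E]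
  [NormedSpace ℝ E] {U : Set V} {f : V → E}

theorem hasDerivAt_iteratedFDeriv_line (hU : IsOpen U) (hf : ContDiffOn ℝ ∞ f U) (n : ℕ) {t : ℝ}
    {ξ : V} (h : t • ξ ∈ U) :
    HasDerivAt (fun s : ℝ => iteratedFDeriv ℝ n f (s • ξ) fun _ => ξ)
      (iteratedFDeriv ℝ (n + 1) f (t • ξ) fun _ => ξ) t := by
  have h1 : DifferentiableAt ℝ (iteratedFDeriv ℝ n f) (t • ξ) :=
    (hf.contDiffAt (hU.mem_nhds h)).differentiableAt_iteratedFDeriv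
      (by exact_mod_cast ENat.natCast_lt_top n)
  have h2 := h1.hasFDerivAt.comp_hasDerivAt t ((hasDerivAt_id t).smul_const ξ)
  have h3 := (ContinuousMultilinearMap.apply ℝ (fun _ : Fin n => V) E
    fun _ => ξ).hasFDerivAt.comp_hasDerivAt t h2
  refine h3.congr_deriv ?_
  rw [iteratedFDeriv_succ_apply_left]
  simp [Fin.tail_def]

theorem iteratedDerivWithin_line (hU : IsOpen U) (hf : ContDiffOn ℝ ∞ f U) {s : Set ℝ} {ξ : V}
    (hs : ∀ t ∈ s, t • ξ ∈ U) (hsd : UniqueDiffOn ℝ s) (n : ℕ) :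
    ∀ t ∈ s, iteratedDerivWithin n (fun r : ℝ => f (r • ξ)) s t =
      iteratedFDeriv ℝ n f (t • ξ) fun _ => ξ := by
  induction n with
  | zero => simp
  | succ n ih =>
    intro t ht
    rw [iteratedDerivWithin_succ, derivWithin_congr ih (ih t ht)]
    exact (hasDerivAt_iteratedFDeriv_line hU hf n (hs t ht)).hasDerivWithinAt.derivWithin (hsd t ht)

/-- Taylor's theorem at the origin for a smooth function on an open set. -/
theorem taylor_isBigO [FiniteDimensional ℝ V] (hU : IsOpen U) (h0 : (0 : V) ∈ U)
    (hf : ContDiffOn ℝ ∞ f U) (n : ℕ) :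
    (fun ξ : V => f ξ - ∑ ℓ ∈ Finset.range (n + 1),
      (1 / (ℓ.factorial : ℝ)) • iteratedFDeriv ℝ ℓ f 0 fun _ => ξ) =O[𝓝 0]
      fun ξ => ‖ξ‖ ^ (n + 1) := by
  have := FiniteDimensional.proper_real V
  obtain ⟨r, hr, hrU⟩ := Metric.nhds_basis_closedBall.mem_iff.1 (hU.mem_nhds h0)
  have hcont : ContinuousOn (iteratedFDeriv ℝ (n + 1) f) (Metric.closedBall 0 r) := by
    intro p hp
    exact ((hf.contDiffAt (hU.mem_nhds (hrU hp))).differentiableAt_iteratedFDeriv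
      (by exact_mod_cast ENat.natCast_lt_top (n + 1))).continuousAt.continuousWithinAt
  obtain ⟨C, hC⟩ := (isCompact_closedBall (0 : V) r).exists_bound_of_continuousOn hcont
  -- On the segment to `ξ` the `(n + 1)`-st derivative is at most `C ‖ξ‖ ^ (n + 1)`; the mean-value
  -- remainder divides this by `n!`.
  refine IsBigO.of_bound (C / n.factorial) ?_
  filter_upwards [Metric.closedBall_mem_nhds (0 : V) hr] with ξ hξ
  have hmem : ∀ t ∈ Icc (0 : ℝ) 1, t • ξ ∈ Metric.closedBall (0 : V) r := by
    intro t ht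
    rw [mem_closedBall_zero_iff] at hξ ⊢
    rw [norm_smul, Real.norm_of_nonneg ht.1]
    exact (mul_le_of_le_one_left (norm_nonneg _) ht.2).trans hξ
  have hD := iteratedDerivWithin_line hU hf (s := Icc (0 : ℝ) 1) (ξ := ξ)
    (fun t ht => hrU (hmem t ht)) (uniqueDiffOn_Icc zero_lt_one)
  have hline : ContDiffOn ℝ (n + 1) (fun t : ℝ => f (t • ξ)) (Icc 0 1) :=
    (hf.comp (f := fun t : ℝ => t • ξ) (by fun_prop) fun t ht => hrU (hmem t ht)).of_le
      (by exact_mod_cast le_top)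
  have hb := taylor_mean_remainder_bound (C := C * ‖ξ‖ ^ (n + 1)) zero_le_one hline
    (right_mem_Icc.2 zero_le_one) (by
      intro t ht
      rw [hD _ t ht]
      refine (ContinuousMultilinearMap.le_opNorm _ _).trans ?_
      simp only [Finset.prod_const, Finset.card_univ, Fintype.card_fin]
      exact mul_le_mul_of_nonneg_right (hC _ (hmem t ht)) (by positivity))
  rw [taylor_within_apply] at hb
  simp only [sub_zero, one_pow, mul_one, one_smul] at hb
  rw [Finset.sum_congr rfl fun ℓ _ => by rw [hD ℓ 0 (left_mem_Icc.2 zero_le_one)]] at hb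
  simp only [zero_smul] at hb
  simp only [one_div, norm_pow, norm_norm]
  exact hb.trans_eq (by ring)

end Taylor

/-! ### Evaluating the derivatives of the metric at the origin -/

section Main

variable {V : Type*} [NormedAddCommGroup V] [NormedSpace ℝ V] [FiniteDimensional ℝ V]
  {U : Set V} {g : V → V →L[ℝ] V →L[ℝ] ℝ}

/-- Taking adjoints reverses products, so if the generators act self-adjointly, `star` acts as the
adjoint for `B`. -/
theorem map_star_adjoint (B : V →L[ℝ] V →L[ℝ] ℝ) (φ : FreeAlg →ₐ[ℝ] (V →L[ℝ] V))
    (h : ∀ i x y, B (φ (FreeAlgebra.ι ℝ i) x) y = B x (φ (FreeAlgebra.ι ℝ i) y)) (P : FreeAlg) :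
    ∀ x y, B (φ (star P) x) y = B x (φ P y) := by
  induction P using FreeAlgebra.induction with
  | grade0 r => intro x y; rw [FreeAlgebra.star_algebraMap]; simp [Algebra.algebraMap_eq_smul_one]
  | grade1 i => simpa using h i
  | mul a b ha hb => intro x y; simp [ha, hb]
  | add a b ha hb => intro x y; simp [ha, hb]

variable (hg : IsPseudoRiemannianMetricOn g U) (hU : IsOpen U)

include hg
theorem contDiffOn_toEndo : ContDiffOn ℝ ∞ (fun η => toEndo (g 0) (g η)) U :=
  contDiffOn_const.clm_comp hg.smooth

include hU
/-- The derivatives of the metric along a radial line. -/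
theorem apply_iteratedFDeriv_toEndo (h0 : (0 : V) ∈ U) (ξ x y : V) (n : ℕ) :
    ∀ t : ℝ, t • ξ ∈ U →
      g 0 (iteratedFDeriv ℝ n (fun η => toEndo (g 0) (g η)) (t • ξ) (fun _ => ξ) x) y =
        ∑ ij ∈ Finset.HasAntidiagonal.antidiagonal n, n.choose ij.1 •
          g (t • ξ) (iterCov (fun s : ℝ => christoffel g (s • ξ) ξ) ij.2 t x)
            (iterCov (fun s : ℝ => christoffel g (s • ξ) ξ) ij.1 t y) := by
  have hI := isOpen_smul_preimage hU ξ
  set A := fun s : ℝ => christoffel g (s • ξ) ξ with hA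
  have hF : ∀ n, ∀ t : ℝ, t • ξ ∈ U → HasDerivAt (iterCov A n) _ t := fun n t ht =>
    hasDerivAt_iterCov hI (contDiffOn_christoffel_line hg hU ξ) n ht
  induction n with
  | zero =>
    intro t ht
    simp [iterCov, toEndo_spec _ _ (hg.nondegenerate 0 h0)]
  | succ n ih =>
    intro t ht
    have h1 := ((hasDerivAt_const t (g 0)).clm_apply
      ((hasDerivAt_iteratedFDeriv_line hU (contDiffOn_toEndo hg) n ht).clm_apply
        (hasDerivAt_const t x))).clm_apply (hasDerivAt_const t y)
    -- For scalars no correction is needed: the `Γ`-terms from the metric cancel those in `F_n' =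
    -- F_{n+1} - A F_n`, so `L = 0`.
    have h2 := hasDerivAt_leibniz_sum
      (fun i j (s : ℝ) => g (s • ξ) (iterCov A j s x) (iterCov A i s y)) 0 t (fun i j => by
        refine (hasDerivAt_metric_line hg hU ht ((hF j t ht).clm_apply (hasDerivAt_const t x))
          ((hF i t ht).clm_apply (hasDerivAt_const t y))).congr_deriv ?_
        simp [hA, add_comm]) n
    have h3 := h2.congr_of_eventuallyEq (f₁ := fun s : ℝ =>
      g 0 (iteratedFDeriv ℝ n (fun η => toEndo (g 0) (g η)) (s • ξ) (fun _ => ξ) x) y) (by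
        filter_upwards [hI.mem_nhds ht] with s hs using ih s hs)
    have h4 := h1.unique h3
    simpa using h4

theorem iteratedFDeriv_toEndo_eq (hn : IsInNormalCoordinates g U) (h0 : (0 : V) ∈ U) (k ℓ : ℕ)
    (hℓ : ℓ ≤ k + 2) (ξ : V) :
    iteratedFDeriv ℝ ℓ (fun η => toEndo (g 0) (g η)) 0 (fun _ => ξ) =
      substitute (fun j : Fin (k + 1) => symCurv g j) (Q ℓ) ξ := by
  set φ : FreeAlg →ₐ[ℝ] (V →L[ℝ] V) := (Pi.evalAlgHom ℝ (fun _ : V => V →L[ℝ] V) ξ).comp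
    (FreeAlgebra.lift ℝ (fun i : {i : ℕ // 2 ≤ i} => if h : i.1 - 2 < k + 1 then
      (fun j : Fin (k + 1) => symCurv g j) ⟨i.1 - 2, h⟩ else 0)) with hφ
  have hφs : ∀ P, substitute (fun j : Fin (k + 1) => symCurv g j) P ξ = φ P := fun P => rfl
  have hφι : ∀ i : {i : ℕ // 2 ≤ i}, φ (FreeAlgebra.ι ℝ i) =
      if i.1 - 2 < k + 1 then symCurv g (i.1 - 2) ξ else 0 := by
    intro i
    rw [hφ, AlgHom.comp_apply, FreeAlgebra.lift_ι_apply]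
    split_ifs <;> rfl
  have h0' : (0 : ℝ) • ξ ∈ U := by simpa using h0
  have hI := isOpen_smul_preimage hU ξ
  set A := fun s : ℝ => christoffel g (s • ξ) ξ with hA
  have hF : ∀ n ≤ k + 2, φ (Qtilde n) = iterCov A n 0 := by
    have hJ := iterCov_jacobi hI (contDiffOn_christoffel_line hg hU ξ) (jacobiOp g ξ)
      (fun n t ht => hasDerivAt_jacobiOp hg hU hn h0 ξ n ht)
      (fun t ht => jacobi_equation hg hU hn h0 ξ ht)
    -- At `t = 0` the summand with factor `t` drops out: level `0` gives `F_1 = 0`, level `n + 1`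
    -- the recursion for `F_{n+2}`. Only generators of index at most `k + 2` enter, so those sent to
    -- `0` by `substitute` do not matter.
    refine map_Qtilde_eq φ (fun j => jacobiOp g ξ j 0) (fun n => iterCov A n 0) (k + 2) ?_ rfl ?_ ?_
    · intro i hi
      rw [hφι, if_pos (by omega), jacobiOp_zero]
    · simpa using hJ 0 0 h0'
    · intro n
      have := hJ (n + 1) 0 h0'
      simp only [zero_smul, zero_add, Nat.add_sub_cancel] at this
      rw [← this]
      push_cast
      congr 2
      ring
  have hadj : ∀ i x y, g 0 (φ (FreeAlgebra.ι ℝ i) x) y = g 0 x (φ (FreeAlgebra.ι ℝ i) y) := by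
    intro i x y
    rw [hφι]
    split_ifs
    · exact symCurv_symm hg hU hn h0 ξ _ x y
    · simp
  rw [hφs]
  ext x
  refine eq_of_forall_apply (g 0) (hg.nondegenerate 0 h0) fun y => ?_
  have h1 := apply_iteratedFDeriv_toEndo hg hU h0 ξ x y ℓ 0 h0'
  rw [zero_smul] at h1
  rw [h1, Finset.Nat.sum_antidiagonal_eq_sum_range_succ_mk, Q]
  simp only [map_sum, map_smul, map_mul, sum_apply, smul_apply, mul_apply_eq_comp]
  refine Finset.sum_congr rfl fun i hi => ?_
  have hi' : i ≤ ℓ := by simpa [Nat.lt_succ_iff] using hi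
  rw [hg.symm 0 h0, ← hF i (by omega), ← hF (ℓ - i) (by omega),
    map_star_adjoint (g 0) φ hadj, hg.symm 0 h0, nsmul_eq_mul, smul_eq_mul]

end Main

end NormalJet

open NormalJet

theorem mainTheorem2 {V : Type*} [NormedAddCommGroup V] [NormedSpace ℝ V] [FiniteDimensional ℝ V]
    (U : Set V) (hU : IsOpen U) (h0 : (0 : V) ∈ U) (hstar : StarConvex ℝ 0 U)
    (g : V → V →L[ℝ] V →L[ℝ] ℝ) (hg : IsPseudoRiemannianMetricOn g U)
    (hnormal : IsInNormalCoordinates g U) (k : ℕ) :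
    (∀ ℓ ≤ k + 2, ∀ ξ : V,
      iteratedFDeriv ℝ ℓ (fun η => toEndo (g 0) (g η)) 0 (fun _ => ξ) =
        substitute (fun j : Fin (k + 1) => symCurv g j) (Q ℓ) ξ) ∧
    (fun ξ : V => toEndo (g 0) (g ξ) -
        ∑ ℓ ∈ Finset.range (k + 3), (1 / (ℓ.factorial : ℝ)) •
          substitute (fun j : Fin (k + 1) => symCurv g j) (Q ℓ) ξ)
      =O[𝓝 0] fun ξ => ‖ξ‖ ^ (k + 3) := by
  have h := fun ℓ hℓ ξ => iteratedFDeriv_toEndo_eq hg hU hnormal h0 k ℓ hℓ ξ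
  refine ⟨h, ?_⟩
  refine (taylor_isBigO hU h0 (contDiffOn_toEndo hg) (k + 2)).congr_left fun ξ => ?_
  congr 1
  refine Finset.sum_congr rfl fun ℓ hℓ => ?_
  rw [h ℓ (by have := Finset.mem_range.1 hℓ; omega) ξ]
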